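/- **Setting.** Let $V$ be a set of $n\ge 2$ nodes with real values $(v_i)_{i\in V}$ whose average $x_{ave}=\frac1n\sum_i v_i$ is nonzero. Let $\mathbb F$ be a ranking forest on $V$: every node has a rank, and each node is either a root or is attached to a parent of strictly higher rank. Let $\tilde V$ be the set of roots and $m=|\tilde V|$. For a root $r$ let $x_r$ be the sum of the values $v_i$ and $g_r$ the number of nodes in its tree. Let $z$ be the root of a largest tree, i.e. $g_z=\max_r g_r$. **Gossip-ave.** Each root $i$ starts with $(s_{0,i},g_{0,i})=(x_i,g_i)$. In every round $t\ge1$ each root $i$, independently of everything else, selects a node of $V$ uniformly at random, sends it $(s_{t-1,i}/2,\;g_{t-1,i}/2)$ and keeps the other half; the selected node forwards the message to the root of its tree, so root $r$ is selected with probability proportional to its tree size $g_r$. Independently, each message is lost with a fixed probability $\rho\in[0,\frac14]$ (the case $\rho=0$ is included), and then the sender keeps that half, too. Each root adds what it receives to what it kept, which gives $(s_{t,i},g_{t,i})$, and its estimate of the average is $\hat x_{ave,t,i}=s_{t,i}/g_{t,i}$. Put $\kappa=\dfrac{\sum_{r\in\tilde V}|x_r|}{\left|\sum_{r\in\tilde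 V}x_r\right|}\ge 1$; thus $\kappa=1$ if all local sums $x_r$ have the same sign. **Theorem.** There is an absolute constant $C>0$ such that for all $n$, $V$, $v$, $\mathbb F$, $z$, $\rho$ as above and every $\alpha>0$ there is a time $T_{ave}\in\mathbb N$ with $$T_{ave}\le C\,(\log m+\alpha\log n+\log\kappa)\quad\text{and}\quad T_{ave}\le C\,\bigl((1+\alpha)\log n+\log\kappa\bigr)$$ such that $$\Pr\left[\ \forall t\ge T_{ave}:\ \frac{|\hat x_{ave,t,z}-x_{ave}|}{|x_{ave}|}\le\frac{2}{n^{\alpha}-1}\ \right]\ \ge\ 1-\frac1{n^{\alpha}} .$$ In particular $T_{ave}=O(\log m+\alpha\log n)$, which is $O(\log n)$ for fixed $\alpha$, if all local sums have the same sign, and more generally whenever $\kappa=O(n^{\alpha})$. -/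

import Mathlib

open MeasureTheory

noncomputable section

/-- A ranking forest on the node set `V`: every node has a rank, and every node is either a root
(it has no parent) or is attached to a parent of strictly higher rank. -/
structure RankingForest (V : Type*) where
  rank : V → ℝ
  parent : V → Option V
  rank_lt_of_parent : ∀ i j, parent i = some j → rank i < rank j

/-- What happens to the message that a root sends in one round: either it is lost, or it is
delivered to a node of the network. -/
inductive Call (V : Type*) where
  | lost : Call V
  | to (u : V) : Call V

instance Call.instMeasurableSpace (V : Type*) : MeasurableSpace (Call V) := ⊤

/-- The law of one call: with probability `ρ` the message is lost; otherwise it goes to a node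
chosen uniformly at random from the whole node set `V`. -/
def callLaw (V : Type*) [Fintype V] (ρ : unitInterval) : Measure (Call V) :=
  ENNReal.ofReal ρ • Measure.dirac Call.lost +
    ∑ u : V, ENNReal.ofReal ((1 - ρ) / Fintype.card V) • Measure.dirac (Call.to u)

instance callLaw.instIsProbabilityMeasure (V : Type*) [Fintype V] [Nonempty V]
    (ρ : unitInterval) : IsProbabilityMeasure (callLaw V ρ) := by
  constructor
  have hV : (Fintype.card V : ℝ) ≠ 0 := by exact_mod_cast Fintype.card_ne_zero
  have h0 : (0 : ℝ) ≤ ρ := ρ.2.1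
  have h1 : (0 : ℝ) ≤ 1 - ρ := sub_nonneg.2 ρ.2.2
  simp only [callLaw, Measure.add_apply, Measure.smul_apply, Measure.finsetSum_apply,
    measure_univ, smul_eq_mul, mul_one, Finset.sum_const, Finset.card_univ, nsmul_eq_mul]
  rw [← ENNReal.ofReal_natCast, ← ENNReal.ofReal_mul (by positivity),
    ← ENNReal.ofReal_add h0 (by positivity), mul_div_cancel₀ _ hV]
  simp

namespace RankingForest

variable {V : Type*} (F : RankingForest V)

/-- The roots of the forest. -/
abbrev Root : Type _ := {i : V // F.parent i = none}

/-- The root of the tree containing a node, found by following the parents upwards. -/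
def rootOf [Fintype V] (F : RankingForest V) (i : V) : F.Root :=
  match h : F.parent i with
  | none => ⟨i, h⟩
  | some j => rootOf F j
termination_by (Finset.univ.filter fun k => F.rank i < F.rank k).card
decreasing_by
  have hij := F.rank_lt_of_parent i j h
  apply Finset.card_lt_card
  rw [Finset.ssubset_iff_of_subset]
  · exact ⟨j, by simpa using hij, by simp⟩
  · intro k hk
    simp only [Finset.mem_filter, Finset.mem_univ, true_and] at hk ⊢
    exact hij.trans hk

variable [Fintype V]

open Classical in
/-- The nodes of the tree with root `r`. -/
def tree (r : F.Root) : Finset V := Finset.univ.filter fun i => F.rootOf i = r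

/-- The local sum at the root `r`: the sum of the node values over its tree. -/
def localSum (v : V → ℝ) (r : F.Root) : ℝ := ∑ i ∈ F.tree r, v i

/-- The number of nodes of the tree with root `r`. -/
def treeSize (r : F.Root) : ℕ := (F.tree r).card

/-- A realisation of all calls: `ω (t, i)` is the fate of the message that the root `i` sends
in round `t + 1`. -/
abbrev Calls : Type _ := ℕ × F.Root → Call V

/-- All calls, of all roots in all rounds, are independent with law `callLaw V ρ`. -/
def callMeasure (ρ : unitInterval) : Measure F.Calls :=
  Measure.infinitePi fun _ : ℕ × F.Root => callLaw V ρ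

/-- The root at which the half sent by the root `i` in round `t + 1` ends up. A message delivered
to a node is forwarded to the root of its tree; the half in a lost message stays with its
sender. -/
def dest (ω : F.Calls) (t : ℕ) (i : F.Root) : F.Root :=
  match ω (t, i) with
  | Call.lost => i
  | Call.to u => F.rootOf u

open Classical in
/-- The values held by the roots after `t` rounds, starting from `x`: in each round every root
keeps one half of its value, sends the other half away, and adds up what it has received. -/
def gossip (ω : F.Calls) (x : F.Root → ℝ) : ℕ → F.Root → ℝ
  | 0, i => x i
  | t + 1, i => gossip ω x t i / 2 +
      ∑ j ∈ Finset.univ.filter (fun j => F.dest ω t j = i), gossip ω x t j / 2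

/-- The estimate `s / g` of the average at the root `i` after `t` rounds: `s` starts from the
local sums and `g` from the tree sizes, and both are gossiped with the same calls. -/
def estimate (v : V → ℝ) (ω : F.Calls) (t : ℕ) (i : F.Root) : ℝ :=
  F.gossip ω (F.localSum v) t i / F.gossip ω (fun r => (F.treeSize r : ℝ)) t i

/-- The cancellation ratio `∑ |x_r| / |∑ x_r|` of the local sums `x_r`. It is `1` when they all
have the same sign. -/
def cancellation (v : V → ℝ) : ℝ :=
  (∑ r, |F.localSum v r|) / |∑ r, F.localSum v r|

end RankingForest

/-- The average of the node values. -/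
def nodeAverage {V : Type*} [Fintype V] (v : V → ℝ) : ℝ := (∑ i, v i) / Fintype.card V

end

/-! ### The finite probability space of one round. -/

noncomputable section

/-! Gossip is linear. The relative error at `z` is therefore |d_t(z)| / w_t(z), where d starts from
the normalised deviation of the local sums (total 0), w starts from the tree shares (total 1), and
both use the same calls. The two factors are estimated separately and joined by a union bound, so
their dependence is harmless.

Numerator: given the past, the calls of a round are independent, and a variance computation shows
that the expected energy ∑ d_i² of a zero-sum vector shrinks by 41/64 per round
(`integral_energy_step_le_of_sum_eq_zero`). Markov's inequality then bounds |d_t(z)|.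

Denominator: the deterministic bound w_t(z) ≥ 2^(-t) p, with p the share of `z`, is too weak against
a decay of |d_t| like (41/64)^(t/2). But w(z) at most halves per round, so w_t(z) < (p/4) 2^(-k)
forces w(z) < p/8 right after the first of the last k rounds, and correspondingly smaller values
after the later ones. In every round `z` receives of order p in expectation, because its tree is
largest the energy of w relaxes to O(p), and a one-sided Chebyshev bound makes each such failure
cost a constant factor. The energy is random, so it is carried along in the potential 1 +
energy/(9p), which contracts by 31/32 on failure (`lintegral_step_lt_le`, `measure_gossip_lt_le`).

With k = t/4 both failure probabilities decay geometrically in t. Summing over t ≥ T leaves a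
prefactor polynomial in κ, m and n^α, which T of the order of its logarithm absorbs. -/

instance Call.instFinite (V : Type*) [Finite V] : Finite (Call V) :=
  Finite.of_surjective (fun o : Option V => o.elim Call.lost Call.to) fun
    | Call.lost => ⟨none, rfl⟩
    | Call.to u => ⟨some u, rfl⟩

instance Call.instDiscreteMeasurableSpace (V : Type*) : DiscreteMeasurableSpace (Call V) :=
  ⟨fun _ => trivial⟩

theorem integral_callLaw {V : Type*} [Fintype V] [Nonempty V] (ρ : unitInterval)
    (f : Call V → ℝ) :
    ∫ c, f c ∂callLaw V ρ =
      ρ * f Call.lost + ∑ u, (1 - (ρ : ℝ)) / Fintype.card V * f (Call.to u) := by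
  have h0 : (0 : ℝ) ≤ ρ := ρ.2.1
  have h1 : (0 : ℝ) ≤ (1 - ρ) / Fintype.card V :=
    div_nonneg (sub_nonneg.2 ρ.2.2) (Nat.cast_nonneg _)
  have hi : ∀ (c : Call V) (r : ℝ), Integrable f (ENNReal.ofReal r • Measure.dirac c) :=
    fun c r => Integrable.smul_measure (integrable_dirac (by simp)) ENNReal.ofReal_ne_top
  rw [callLaw, integral_add_measure (hi _ _) (integrable_finsetSum_measure.2 fun u _ => hi _ _),
    integral_finsetSum_measure fun u _ => hi _ _]
  simp [integral_smul_measure, ENNReal.toReal_ofReal, h0, h1]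

/-- The second moment of a sum of independent variables is at most the square of its mean plus
the sum of the second moments. -/
theorem integral_add_sum_sq_le {ι Ω : Type*} [Fintype ι] [Finite Ω] [MeasurableSpace Ω]
    [DiscreteMeasurableSpace Ω] (μ : Measure Ω) [IsProbabilityMeasure μ] (X : ι → Ω → ℝ) (c : ℝ) :
    ∫ a, (c + ∑ k, X k (a k)) ^ 2 ∂Measure.pi (fun _ : ι => μ) ≤
      (c + ∑ k, ∫ w, X k w ∂μ) ^ 2 + ∑ k, ∫ w, X k w ^ 2 ∂μ := by
  have hm : ∀ k, MemLp (X k) 2 μ := fun k => MemLp.of_discrete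
  have hv := ProbabilityTheory.variance_sum_pi (μ := fun _ : ι => μ) hm
  rw [ProbabilityTheory.variance_eq_sub MemLp.of_discrete] at hv
  have hs : ∑ k, ProbabilityTheory.variance (X k) μ ≤ ∑ k, ∫ w, X k w ^ 2 ∂μ :=
    Finset.sum_le_sum fun k _ => ProbabilityTheory.variance_le_expectation_sq
      (hm k).aestronglyMeasurable
  have hmean : ∫ a, ∑ k, X k (a k) ∂Measure.pi (fun _ : ι => μ) = ∑ k, ∫ w, X k w ∂μ := by
    rw [integral_finsetSum _ fun _ _ => Integrable.of_finite]
    exact Finset.sum_congr rfl fun k _ =>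
      integral_comp_eval (μ := fun _ : ι => μ) (hm k).aestronglyMeasurable
  have hsplit : ∫ a, (c + ∑ k, X k (a k)) ^ 2 ∂Measure.pi (fun _ : ι => μ) =
      c ^ 2 + 2 * c * ∑ k, ∫ w, X k w ∂μ +
        ∫ a, (∑ k, X k (a k)) ^ 2 ∂Measure.pi (fun _ : ι => μ) := by
    rw [← hmean, ← integral_const_mul]
    simp_rw [add_sq]
    rw [integral_add Integrable.of_finite Integrable.of_finite,
      integral_add Integrable.of_finite Integrable.of_finite]
    simp
  simp only [Pi.pow_apply, Finset.sum_apply] at hv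
  rw [hmean] at hv
  rw [hsplit]
  linarith

/-! ### The Markov property of the gossip process. -/

namespace RankingForest

variable {V : Type*} (F : RankingForest V)

/-- The realisation of all calls whose first round is `a` and whose later rounds are `ω`. -/
def consRound (a : F.Root → Call V) (ω : F.Calls) : F.Calls
  | (0, i) => a i
  | (t + 1, i) => ω (t, i)

theorem measurable_consRound :
    Measurable fun p : (F.Root → Call V) × F.Calls => F.consRound p.1 p.2 := by
  refine measurable_pi_lambda _ fun q => ?_
  rcases q with ⟨_ | t, i⟩
  · exact (measurable_pi_apply i).comp measurable_fst
  · exact (measurable_pi_apply (t, i)).comp measurable_snd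

variable [Fintype V]

/-- The root that receives the half sent by the root `i`, given the fate of its message. -/
def target (c : Call V) (i : F.Root) : F.Root :=
  match c with
  | Call.lost => i
  | Call.to u => F.rootOf u

open Classical in
/-- One round of gossip with the calls `a`. -/
def step (a : F.Root → Call V) (y : F.Root → ℝ) (i : F.Root) : ℝ :=
  y i / 2 + ∑ j, if F.target (a j) j = i then y j / 2 else 0

theorem gossip_succ (ω : F.Calls) (x : F.Root → ℝ) (t : ℕ) :
    F.gossip ω x (t + 1) = F.step (fun j => ω (t, j)) (F.gossip ω x t) := by
  funext i
  simp only [gossip, step, Finset.sum_filter]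
  rfl

theorem gossip_consRound_succ (a : F.Root → Call V) (ω : F.Calls) (x : F.Root → ℝ) (t : ℕ) :
    F.gossip (F.consRound a ω) x (t + 1) = F.gossip ω (F.step a x) t := by
  induction t with
  | zero => rw [gossip_succ]; rfl
  | succ t ih => rw [gossip_succ, ih, gossip_succ]; rfl

theorem measurable_gossip (x : F.Root → ℝ) (t : ℕ) : Measurable fun ω => F.gossip ω x t := by
  classical
  induction t with
  | zero => exact measurable_const
  | succ t ih =>
    simp_rw [gossip_succ]
    refine measurable_pi_lambda _ fun i => ?_
    refine ((measurable_pi_apply i).comp ih).div_const 2 |>.add ?_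
    refine Finset.measurable_sum _ fun j _ => Measurable.ite ?_
      (((measurable_pi_apply j).comp ih).div_const 2) measurable_const
    have hd : MeasurableSet {c : Call V | F.target c j = i} := MeasurableSet.of_discrete
    have hω : Measurable fun ω : F.Calls => ω (t, j) := measurable_pi_apply (t, j)
    exact hω hd

/-- The law of the calls of one round. -/
abbrev roundMeasure (ρ : unitInterval) : Measure (F.Root → Call V) :=
  Measure.pi fun _ => callLaw V ρ

variable [Nonempty V]

instance callMeasure.instIsProbabilityMeasure (ρ : unitInterval) :
    IsProbabilityMeasure (F.callMeasure ρ) := by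
  unfold callMeasure; infer_instance

/-- An i.i.d. family stays i.i.d. when a fresh round is put in front. It suffices to compare
measures of finite cylinders, whose index set splits into round 0 and the shifted later rounds. -/
theorem map_consRound (ρ : unitInterval) :
    ((F.roundMeasure ρ).prod (F.callMeasure ρ)).map (fun p => F.consRound p.1 p.2) =
      F.callMeasure ρ := by
  classical
  refine Measure.eq_infinitePi _ fun s t ht => ?_
  have hinj0 : Function.Injective fun i : F.Root => ((0 : ℕ), i) := fun i j h => by simpa using h
  have hinj1 : Function.Injective fun p : ℕ × F.Root => (p.1 + 1, p.2) := fun p q h => by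
    simpa [Prod.ext_iff] using h
  have hpre : (fun p : (F.Root → Call V) × F.Calls => F.consRound p.1 p.2) ⁻¹' Set.pi s t =
      (Set.pi (s.preimage (fun i : F.Root => ((0 : ℕ), i)) hinj0.injOn) fun i => t (0, i)) ×ˢ
      (Set.pi (s.preimage (fun p : ℕ × F.Root => (p.1 + 1, p.2)) hinj1.injOn)
        fun p => t (p.1 + 1, p.2)) := by
    ext p
    simp only [Set.mem_preimage, Set.mem_pi, Set.mem_prod, Finset.mem_coe, Finset.mem_preimage]
    constructor
    · exact fun h => ⟨fun i hi => h _ hi, fun q hq => h _ hq⟩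
    · rintro ⟨h0, h1⟩ ⟨_ | k, i⟩ hi
      · exact h0 i hi
      · exact h1 (k, i) hi
  rw [Measure.map_apply F.measurable_consRound
    (MeasurableSet.pi s.countable_toSet fun i _ => ht i), hpre, Measure.prod_prod,
    callMeasure, Measure.infinitePi_pi _ fun i _ => ht _, roundMeasure, ← Measure.infinitePi_eq_pi,
    Measure.infinitePi_pi _ fun i _ => ht _,
    Finset.prod_preimage' _ s hinj0.injOn fun q => callLaw V ρ (t q),
    Finset.prod_preimage' _ s hinj1.injOn fun q => callLaw V ρ (t q),
    ← Finset.prod_filter_mul_prod_filter_not s (· ∈ Set.range fun i : F.Root => ((0 : ℕ), i))]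
  congr 2
  refine Finset.filter_congr fun q _ => ?_
  rcases q with ⟨_ | k, i⟩ <;> simp

/-- Conditioning on the first round: every later induction on time generalises the starting vector
and uses this identity or its set version. -/
theorem lintegral_gossip_succ (ρ : unitInterval) (x : F.Root → ℝ) (t : ℕ)
    {f : (F.Root → ℝ) → ENNReal} (hf : Measurable f) :
    ∫⁻ ω, f (F.gossip ω x (t + 1)) ∂F.callMeasure ρ =
      ∫⁻ a, ∫⁻ ω, f (F.gossip ω (F.step a x) t) ∂F.callMeasure ρ ∂F.roundMeasure ρ := by
  have hm := hf.comp (F.measurable_gossip x (t + 1))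
  calc ∫⁻ ω, f (F.gossip ω x (t + 1)) ∂F.callMeasure ρ
      = ∫⁻ p, f (F.gossip (F.consRound p.1 p.2) x (t + 1))
          ∂(F.roundMeasure ρ).prod (F.callMeasure ρ) := by
        conv_lhs => rw [← F.map_consRound ρ]
        exact lintegral_map hm F.measurable_consRound
    _ = _ := by
        simp_rw [← gossip_consRound_succ]
        exact lintegral_prod _ (hm.comp F.measurable_consRound).aemeasurable

theorem measure_gossip_succ (ρ : unitInterval) (x : F.Root → ℝ) (t : ℕ)
    {S : Set (F.Root → ℝ)} (hS : MeasurableSet S) :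
    F.callMeasure ρ {ω | F.gossip ω x (t + 1) ∈ S} =
      ∫⁻ a, F.callMeasure ρ {ω | F.gossip ω (F.step a x) t ∈ S} ∂F.roundMeasure ρ := by
  have h := F.lintegral_gossip_succ ρ x t (measurable_one.indicator hS)
  have hi : ∀ (y : F.Root → ℝ) (k : ℕ), ∫⁻ ω, S.indicator 1 (F.gossip ω y k) ∂F.callMeasure ρ =
      F.callMeasure ρ {ω | F.gossip ω y k ∈ S} := fun y k => by
    exact lintegral_indicator_one (F.measurable_gossip y k hS)
  simpa only [hi] using h

end RankingForest

/-! ### Invariants and moment estimates for a single round. -/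

namespace RankingForest

variable {V : Type*} (F : RankingForest V) [Fintype V]

theorem mem_tree_iff (i : V) (r : F.Root) : i ∈ F.tree r ↔ F.rootOf i = r := by
  simp [tree]

theorem rootOf_root (r : F.Root) : F.rootOf r = r := by
  rw [rootOf]
  split
  · rfl
  · rename_i j h
    exact absurd (r.2.symm.trans h) (by simp)

theorem sum_root_tree (f : V → ℝ) : ∑ r, ∑ i ∈ F.tree r, f i = ∑ i, f i := by
  classical
  rw [← Finset.sum_fiberwise Finset.univ F.rootOf f]
  refine Finset.sum_congr rfl fun r _ => Finset.sum_congr ?_ fun _ _ => rfl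
  ext i
  simp [mem_tree_iff]

theorem treeSize_pos (r : F.Root) : 0 < F.treeSize r :=
  Finset.card_pos.2 ⟨r, (F.mem_tree_iff _ _).2 (F.rootOf_root r)⟩

theorem sum_treeSize : ∑ r, (F.treeSize r : ℝ) = Fintype.card V := by
  simpa [treeSize] using F.sum_root_tree fun _ => (1 : ℝ)

/-- The fraction of the nodes that belong to the tree with root `r`. -/
def share (r : F.Root) : ℝ := F.treeSize r / Fintype.card V

theorem share_nonneg (r : F.Root) : 0 ≤ F.share r := by unfold share; positivity

/-- The sum of the squares of the values at the roots. -/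
def energy (y : F.Root → ℝ) : ℝ := ∑ i, y i ^ 2

theorem energy_nonneg (y : F.Root → ℝ) : 0 ≤ F.energy y :=
  Finset.sum_nonneg fun _ _ => sq_nonneg _

theorem sq_le_energy (y : F.Root → ℝ) (i : F.Root) : y i ^ 2 ≤ F.energy y :=
  Finset.single_le_sum (f := fun i => y i ^ 2) (fun _ _ => sq_nonneg _) (Finset.mem_univ i)

theorem measurable_energy : Measurable F.energy := by
  unfold energy; fun_prop

theorem sum_step (a : F.Root → Call V) (y : F.Root → ℝ) : ∑ i, F.step a y i = ∑ i, y i := by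
  classical
  simp only [step, Finset.sum_add_distrib]
  rw [Finset.sum_comm]
  simp [← Finset.sum_add_distrib]

theorem half_le_step (a : F.Root → Call V) {y : F.Root → ℝ} (hy : ∀ i, 0 ≤ y i) (i : F.Root) :
    y i / 2 ≤ F.step a y i := by
  refine le_add_of_nonneg_right (Finset.sum_nonneg fun j _ => ?_)
  have := hy j
  split_ifs <;> positivity

theorem step_nonneg (a : F.Root → Call V) {y : F.Root → ℝ} (hy : ∀ i, 0 ≤ y i) (i : F.Root) :
    0 ≤ F.step a y i :=
  (div_nonneg (hy i) two_pos.le).trans (F.half_le_step a hy i)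

theorem gossip_nonneg (ω : F.Calls) {y : F.Root → ℝ} (hy : ∀ i, 0 ≤ y i) (t : ℕ) :
    ∀ i, 0 ≤ F.gossip ω y t i := by
  induction t with
  | zero => exact hy
  | succ t ih => rw [gossip_succ]; exact F.step_nonneg _ ih

theorem half_pow_mul_le_gossip (ω : F.Calls) {y : F.Root → ℝ} (hy : ∀ i, 0 ≤ y i) (t : ℕ)
    (i : F.Root) : (1 / 2) ^ t * y i ≤ F.gossip ω y t i := by
  induction t with
  | zero => simp [gossip]
  | succ t ih =>
    rw [gossip_succ, pow_succ]
    have := F.half_le_step (fun j => ω (t, j)) (F.gossip_nonneg ω hy t) i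
    linarith

theorem gossip_sub_smul (ω : F.Calls) (x y : F.Root → ℝ) (b c : ℝ) (t : ℕ) (i : F.Root) :
    F.gossip ω (fun r => b * x r - c * y r) t i = b * F.gossip ω x t i - c * F.gossip ω y t i := by
  induction t generalizing i with
  | zero => rfl
  | succ t ih =>
    simp only [gossip, ih, mul_add, Finset.mul_sum]
    rw [add_sub_add_comm, ← Finset.sum_sub_distrib]
    congr 1
    · ring
    · exact Finset.sum_congr rfl fun _ _ => by ring

theorem sum_div_card_rootOf (w : ℝ) (r : F.Root) [DecidableEq F.Root] :
    ∑ u, w / Fintype.card V * (if F.rootOf u = r then 1 else 0) = w * F.share r := by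
  have h : (Finset.univ.filter fun u => F.rootOf u = r) = F.tree r := by
    ext; simp [mem_tree_iff]
  rw [← Finset.mul_sum, Finset.sum_boole, h, share, treeSize]
  ring

open Classical in
/-- The indicator that a message is delivered to a node of the tree with root `z`. -/
def received (z : F.Root) : Call V → ℝ
  | Call.lost => 0
  | Call.to u => if F.rootOf u = z then 1 else 0

theorem received_sq (z : F.Root) (c : Call V) : F.received z c ^ 2 = F.received z c := by
  cases c <;> simp [received]

theorem sum_received_le_step (a : F.Root → Call V) {y : F.Root → ℝ} (hy : ∀ i, 0 ≤ y i)
    (z : F.Root) : (∑ j, y j * F.received z (a j)) / 2 ≤ F.step a y z := by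
  classical
  rw [Finset.sum_div]
  refine (Finset.sum_le_sum fun j _ => ?_).trans (le_add_of_nonneg_left (div_nonneg (hy z) two_pos.le))
  have hj := hy j
  rcases a j with _ | u
  · simp only [received, mul_zero, zero_div]
    split_ifs <;> positivity
  · by_cases h : F.rootOf u = z <;> simp [received, target, h]

variable [Nonempty V]

theorem sum_share : ∑ r, F.share r = 1 := by
  simp only [share, ← Finset.sum_div, sum_treeSize]
  exact div_self (by exact_mod_cast Fintype.card_ne_zero)

theorem share_pos (r : F.Root) : 0 < F.share r :=
  div_pos (by exact_mod_cast F.treeSize_pos r) (by exact_mod_cast Fintype.card_pos)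

open Classical in
theorem integral_target (ρ : unitInterval) (j i : F.Root) (w : ℝ) :
    ∫ c, (if F.target c j = i then w else 0) ∂callLaw V ρ =
      w * (ρ * (if j = i then 1 else 0) + (1 - ρ) * F.share i) := by
  rw [integral_callLaw, ← F.sum_div_card_rootOf, mul_add, Finset.mul_sum]
  simp only [target]
  congr 1
  · by_cases h : j = i <;> simp [h, mul_comm]
  · refine Finset.sum_congr rfl fun u _ => ?_
    by_cases h : F.rootOf u = i <;> simp [h, mul_comm]

open Classical in
theorem integral_step_sq_le (ρ : unitInterval) (y : F.Root → ℝ) (i : F.Root) :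
    ∫ a, F.step a y i ^ 2 ∂F.roundMeasure ρ ≤
      (((1 + ρ) * y i + (1 - ρ) * F.share i * ∑ j, y j) / 2) ^ 2 +
        ∑ j, (y j / 2) ^ 2 * (ρ * (if j = i then 1 else 0) + (1 - ρ) * F.share i) := by
  refine (integral_add_sum_sq_le (callLaw V ρ)
    (fun j c => if F.target c j = i then y j / 2 else 0) (y i / 2)).trans (le_of_eq ?_)
  simp only [ite_pow, ne_eq, OfNat.ofNat_ne_zero, not_false_eq_true, zero_pow, integral_target]
  congr 2
  simp only [mul_add, Finset.sum_add_distrib, ← Finset.sum_mul, ← Finset.sum_div]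
  simp
  ring

/-- The first sum is the energy of the mean vector. The fluctuation costs at most ∑ (y_j/2)², since
each half arrives at exactly one root and the arrival probabilities add up to 1. -/
theorem integral_energy_step_le (ρ : unitInterval) (y : F.Root → ℝ) :
    ∫ a, F.energy (F.step a y) ∂F.roundMeasure ρ ≤
      ∑ i, (((1 + ρ) * y i + (1 - ρ) * F.share i * ∑ j, y j) / 2) ^ 2 + F.energy y / 4 := by
  classical
  simp only [energy]
  rw [integral_finsetSum _ fun _ _ => Integrable.of_finite]
  refine (Finset.sum_le_sum fun i _ => F.integral_step_sq_le ρ y i).trans (le_of_eq ?_)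
  rw [Finset.sum_add_distrib, Finset.sum_comm (f := fun i j => (y j / 2) ^ 2 * _), Finset.sum_div]
  congr 1
  refine Finset.sum_congr rfl fun j _ => ?_
  rw [← Finset.mul_sum, Finset.sum_add_distrib, ← Finset.mul_sum, ← Finset.mul_sum, sum_share]
  simp
  ring

theorem integral_energy_step_le_of_sum_eq_zero (ρ : unitInterval) (hρ : (ρ : ℝ) ≤ 1 / 4)
    {y : F.Root → ℝ} (hy : ∑ i, y i = 0) :
    ∫ a, F.energy (F.step a y) ∂F.roundMeasure ρ ≤ 41 / 64 * F.energy y := by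
  refine (F.integral_energy_step_le ρ y).trans ?_
  have h0 : (0 : ℝ) ≤ ρ := ρ.2.1
  have h : ∑ i, (((1 + ρ) * y i + (1 - ρ) * F.share i * ∑ j, y j) / 2) ^ 2 =
      ((1 + ρ) / 2) ^ 2 * F.energy y := by
    simp only [hy, energy, Finset.mul_sum]
    exact Finset.sum_congr rfl fun i _ => by ring
  -- For total 0 the mean vector is (1+ρ)/2 · y, and 25/64 + 1/4 = 41/64.
  have hsq : ((1 + (ρ : ℝ)) / 2) ^ 2 ≤ 25 / 64 := by nlinarith
  rw [h]
  linarith [mul_le_mul_of_nonneg_right hsq (F.energy_nonneg y)]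

theorem integral_energy_step_le_of_sum_eq_one (ρ : unitInterval) (hρ : (ρ : ℝ) ≤ 1 / 4)
    {y : F.Root → ℝ} (hy0 : ∀ i, 0 ≤ y i) (hy : ∑ i, y i = 1) {p : ℝ} (hp : ∀ i, F.share i ≤ p) :
    ∫ a, F.energy (F.step a y) ∂F.roundMeasure ρ ≤ 41 / 64 * F.energy y + 3 / 4 * p := by
  refine (F.integral_energy_step_le ρ y).trans ?_
  have h0 : (0 : ℝ) ≤ ρ := ρ.2.1
  have h : ∑ i, (((1 + ρ) * y i + (1 - ρ) * F.share i * ∑ j, y j) / 2) ^ 2 ≤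
      ∑ i, (25 / 64 * y i ^ 2 + (p / 2 * y i + p / 4 * F.share i)) := by
    refine Finset.sum_le_sum fun i _ => ?_
    have hs := F.share_nonneg i
    have h1 : (1 + (ρ : ℝ)) ^ 2 * y i ^ 2 ≤ 25 / 16 * y i ^ 2 :=
      mul_le_mul_of_nonneg_right (by nlinarith) (sq_nonneg _)
    have h2 : (1 - (ρ : ℝ) ^ 2) * (F.share i * y i) ≤ p * y i :=
      (mul_le_of_le_one_left (mul_nonneg hs (hy0 i)) (by nlinarith)).trans
        (mul_le_mul_of_nonneg_right (hp i) (hy0 i))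
    have h3 : (1 - (ρ : ℝ)) ^ 2 * (F.share i * F.share i) ≤ p * F.share i :=
      (mul_le_of_le_one_left (mul_nonneg hs hs) (by nlinarith)).trans
        (mul_le_mul_of_nonneg_right (hp i) hs)
    rw [hy]
    nlinarith
  have hr : ∑ i, (25 / 64 * y i ^ 2 + (p / 2 * y i + p / 4 * F.share i)) =
      25 / 64 * F.energy y + (p / 2 + p / 4) := by
    simp [Finset.sum_add_distrib, ← Finset.mul_sum, hy, sum_share, energy]
  linarith

theorem integral_received (ρ : unitInterval) (z : F.Root) :
    ∫ c, F.received z c ∂callLaw V ρ = (1 - ρ) * F.share z := by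
  classical
  rw [integral_callLaw, ← F.sum_div_card_rootOf]
  simp [received]

/-- The weight sent to the tree of `z`, in units of its share, has mean 1 - ρ ∈ [3/4, 1], and (25/4
- 3/4)² = 121/4. The centre far above the mean gives a Cantelli-type bound: Chebyshev about the mean
would put too large a factor on the energy. -/
theorem integral_deviation_received_le (ρ : unitInterval) (hρ : (ρ : ℝ) ≤ 1 / 4)
    (y : F.Root → ℝ) (hy : ∑ i, y i = 1) (z : F.Root) :
    ∫ a, (-(25 / 4) + ∑ j, y j / F.share z * F.received z (a j)) ^ 2 ∂F.roundMeasure ρ ≤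
      121 / 4 + F.energy y / F.share z := by
  have h0 : (0 : ℝ) ≤ ρ := ρ.2.1
  have hz := F.share_pos z
  refine (integral_add_sum_sq_le (callLaw V ρ)
    (fun j c => y j / F.share z * F.received z c) (-(25 / 4))).trans ?_
  simp only [mul_pow, received_sq, integral_const_mul, integral_received, ← Finset.sum_mul,
    ← Finset.sum_div, hy, div_pow]
  have h1 : 1 / F.share z * ((1 - ρ) * F.share z) = 1 - (ρ : ℝ) := by field_simp
  have h2 : (∑ i, y i ^ 2) / F.share z ^ 2 * ((1 - ρ) * F.share z) =
      (1 - ρ) * (F.energy y / F.share z) := by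
    unfold energy; field_simp
  rw [h1, h2]
  have := div_nonneg (F.energy_nonneg y) hz.le
  nlinarith

theorem lintegral_step_lt_le (ρ : unitInterval) (hρ : (ρ : ℝ) ≤ 1 / 4)
    {y : F.Root → ℝ} (hy0 : ∀ i, 0 ≤ y i) (hy : ∑ i, y i = 1) {z : F.Root}
    (hz : ∀ i, F.share i ≤ F.share z) :
    ∫⁻ a, {a | F.step a y z < F.share z / 8}.indicator
        (fun a => ENNReal.ofReal (1 + F.energy (F.step a y) / F.share z / 9)) a ∂F.roundMeasure ρ ≤
      ENNReal.ofReal (31 / 32 * (1 + F.energy y / F.share z / 9)) := by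
  have hp := F.share_pos z
  have hdev := F.integral_deviation_received_le ρ hρ y hy z
  have hen := F.integral_energy_step_le_of_sum_eq_one ρ hρ hy0 hy hz
  -- On failure the received amount is at most 1/4, at distance at least 6 from 25/4, so the square
  -- divided by 36 dominates the indicator. In expectation the constants give 121/144 + 1/12 ≤ 31/32
  -- and the coefficients of energy/share give 1/36 + 41/576 ≤ 31/288.
  have hpt : ∀ a : F.Root → Call V, {a | F.step a y z < F.share z / 8}.indicator
        (fun a => ENNReal.ofReal (1 + F.energy (F.step a y) / F.share z / 9)) a ≤
      ENNReal.ofReal ((-(25 / 4) + ∑ j, y j / F.share z * F.received z (a j)) ^ 2 / 36 +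
        F.energy (F.step a y) / F.share z / 9) := by
    refine fun a => Set.indicator_apply_le' (fun ha => ENNReal.ofReal_le_ofReal ?_) fun _ => zero_le
    have h : ∑ j, y j / F.share z * F.received z (a j) ≤ 1 / 4 := by
      have := F.sum_received_le_step a hy0 z
      simp only [div_mul_eq_mul_div, ← Finset.sum_div]
      rw [div_le_iff₀ hp]
      have ha' : F.step a y z < F.share z / 8 := ha
      linarith
    nlinarith
  refine (lintegral_mono hpt).trans ?_
  rw [← ofReal_integral_eq_lintegral_ofReal Integrable.of_finite (Filter.Eventually.of_forall
    fun a => by have := F.energy_nonneg (F.step a y); positivity)]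
  refine ENNReal.ofReal_le_ofReal ?_
  rw [integral_add Integrable.of_finite Integrable.of_finite, integral_div, integral_div,
    integral_div]
  have h1 : (∫ a, F.energy (F.step a y) ∂F.roundMeasure ρ) / F.share z ≤
      41 / 64 * (F.energy y / F.share z) + 3 / 4 := by
    rw [div_le_iff₀ hp]
    refine hen.trans (le_of_eq ?_)
    field_simp
  have := div_nonneg (F.energy_nonneg y) hp.le
  linarith

end RankingForest

/-! ### Iteration over the rounds. -/

namespace RankingForest

variable {V : Type*} (F : RankingForest V)

theorem measurableSet_apply_lt (z : F.Root) (c : ℝ) :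
    MeasurableSet {x : F.Root → ℝ | x z < c} :=
  measurableSet_lt (measurable_pi_apply z) measurable_const

variable [Fintype V] [Nonempty V]

theorem lintegral_energy_gossip_le (ρ : unitInterval) (hρ : (ρ : ℝ) ≤ 1 / 4) (t : ℕ)
    {y : F.Root → ℝ} (hy : ∑ i, y i = 0) :
    ∫⁻ ω, ENNReal.ofReal (F.energy (F.gossip ω y t)) ∂F.callMeasure ρ ≤
      ENNReal.ofReal ((41 / 64) ^ t * F.energy y) := by
  induction t generalizing y with
  | zero => simp [gossip]
  | succ t ih =>
    rw [F.lintegral_gossip_succ ρ y t (f := fun x => ENNReal.ofReal (F.energy x))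
      F.measurable_energy.ennreal_ofReal]
    refine (lintegral_mono fun a => ih ((F.sum_step a y).trans hy)).trans ?_
    rw [← ofReal_integral_eq_lintegral_ofReal Integrable.of_finite (Filter.Eventually.of_forall
      fun a => mul_nonneg (by positivity) (F.energy_nonneg _)), integral_const_mul]
    refine ENNReal.ofReal_le_ofReal ?_
    rw [pow_succ, mul_assoc]
    exact mul_le_mul_of_nonneg_left (F.integral_energy_step_le_of_sum_eq_zero ρ hρ hy)
      (by positivity)

theorem measure_gossip_lt_le (ρ : unitInterval) (hρ : (ρ : ℝ) ≤ 1 / 4) {z : F.Root}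
    (hz : ∀ i, F.share i ≤ F.share z) (k : ℕ) {y : F.Root → ℝ} (hy0 : ∀ i, 0 ≤ y i)
    (hy : ∑ i, y i = 1) :
    F.callMeasure ρ {ω | F.gossip ω y k z < F.share z / 4 * (1 / 2) ^ k} ≤
      ENNReal.ofReal ((31 / 32) ^ k * (1 + F.energy y / F.share z / 9)) := by
  have hp := F.share_pos z
  induction k generalizing y with
  | zero =>
    refine prob_le_one.trans ?_
    rw [← ENNReal.ofReal_one]
    refine ENNReal.ofReal_le_ofReal ?_
    have := F.energy_nonneg y
    rw [pow_zero, one_mul]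
    exact le_add_of_nonneg_right (by positivity)
  | succ k ih =>
    have hpt : ∀ a, F.callMeasure ρ {ω | F.gossip ω (F.step a y) k z <
          F.share z / 4 * (1 / 2) ^ (k + 1)} ≤
        ENNReal.ofReal ((31 / 32) ^ k) * {a | F.step a y z < F.share z / 8}.indicator
          (fun a => ENNReal.ofReal (1 + F.energy (F.step a y) / F.share z / 9)) a := by
      intro a
      have hs0 := F.step_nonneg a hy0
      -- If the first round reaches share/8, the remaining k halvings cannot go below the threshold.
      -- Otherwise the induction hypothesis applies, with a threshold twice as large, and the round
      -- has paid its factor 31/32.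
      by_cases ha : F.step a y z < F.share z / 8
      · rw [Set.indicator_of_mem (show a ∈ {a | F.step a y z < F.share z / 8} from ha),
          ← ENNReal.ofReal_mul (by positivity)]
        refine (measure_mono fun ω hω => ?_).trans (ih hs0 ((F.sum_step a y).trans hy))
        have hlt : F.gossip ω (F.step a y) k z < F.share z / 4 * (1 / 2) ^ (k + 1) := hω
        refine hlt.trans_le ?_
        rw [pow_succ]
        have : 0 ≤ F.share z / 4 * (1 / 2) ^ k := by positivity
        linarith
      · have he : {ω | F.gossip ω (F.step a y) k z < F.share z / 4 * (1 / 2) ^ (k + 1)} = ∅ := by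
          refine Set.eq_empty_of_forall_notMem fun ω hω => ?_
          have h1 := F.half_pow_mul_le_gossip ω hs0 k z
          have h2 : (1 / 2 : ℝ) ^ k * (F.share z / 8) ≤ (1 / 2) ^ k * F.step a y z :=
            mul_le_mul_of_nonneg_left (not_lt.1 ha) (by positivity)
          have h3 : F.gossip ω (F.step a y) k z < F.share z / 4 * (1 / 2) ^ (k + 1) := hω
          rw [pow_succ] at h3
          linarith
        rw [he, measure_empty]
        exact zero_le
    have hsplit := F.measure_gossip_succ ρ y k
      (F.measurableSet_apply_lt z (F.share z / 4 * (1 / 2) ^ (k + 1)))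
    simp only [Set.mem_ofPred_eq] at hsplit
    rw [hsplit]
    refine (lintegral_mono hpt).trans ?_
    rw [lintegral_const_mul' _ _ ENNReal.ofReal_ne_top, pow_succ, mul_assoc,
      ENNReal.ofReal_mul (by positivity)]
    gcongr
    exact F.lintegral_step_lt_le ρ hρ hy0 hy hz

/-- Only the last k rounds are used to catch failures; during the s rounds before them energy/share
follows e ↦ 41/64 e + 3/4, whose fixed point 48/23 lies below 3. -/
theorem measure_gossip_add_lt_le (ρ : unitInterval) (hρ : (ρ : ℝ) ≤ 1 / 4) {z : F.Root}
    (hz : ∀ i, F.share i ≤ F.share z) (k s : ℕ) {y : F.Root → ℝ} (hy0 : ∀ i, 0 ≤ y i)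
    (hy : ∑ i, y i = 1) :
    F.callMeasure ρ {ω | F.gossip ω y (k + s) z < F.share z / 4 * (1 / 2) ^ k} ≤
      ENNReal.ofReal ((31 / 32) ^ k *
        (1 + ((41 / 64) ^ s * (F.energy y / F.share z) + 3 * (1 - (41 / 64) ^ s)) / 9)) := by
  have hp := F.share_pos z
  induction s generalizing y with
  | zero =>
    simpa using F.measure_gossip_lt_le ρ hρ hz k hy0 hy
  | succ s ih =>
    have hsplit := F.measure_gossip_succ ρ y (k + s)
      (F.measurableSet_apply_lt z (F.share z / 4 * (1 / 2) ^ k))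
    simp only [Set.mem_ofPred_eq] at hsplit
    rw [← add_assoc, hsplit]
    refine (lintegral_mono fun a => ih (F.step_nonneg a hy0) ((F.sum_step a y).trans hy)).trans ?_
    have hs : (41 / 64 : ℝ) ^ s ≤ 1 := pow_le_one₀ (by norm_num) (by norm_num)
    have hs0 : (0 : ℝ) < (41 / 64) ^ s := by positivity
    rw [← ofReal_integral_eq_lintegral_ofReal Integrable.of_finite (Filter.Eventually.of_forall
      fun a => ?_)]
    · refine ENNReal.ofReal_le_ofReal ?_
      rw [integral_const_mul, integral_add Integrable.of_finite Integrable.of_finite, integral_div,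
        integral_add Integrable.of_finite Integrable.of_finite, integral_const_mul, integral_div]
      simp only [integral_const, probReal_univ, smul_eq_mul, one_mul]
      have h1 : (∫ a, F.energy (F.step a y) ∂F.roundMeasure ρ) / F.share z ≤
          41 / 64 * (F.energy y / F.share z) + 3 / 4 := by
        rw [div_le_iff₀ hp]
        refine (F.integral_energy_step_le_of_sum_eq_one ρ hρ hy0 hy hz).trans (le_of_eq ?_)
        field_simp
      have h2 := mul_le_mul_of_nonneg_left h1 hs0.le
      refine mul_le_mul_of_nonneg_left ?_ (by positivity)
      rw [pow_succ]
      linarith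
    · have h1 := div_nonneg (F.energy_nonneg (F.step a y)) hp.le
      have h2 := mul_nonneg hs0.le h1
      exact mul_nonneg (by positivity) (by linarith)

theorem energy_share_le {z : F.Root} (hz : ∀ i, F.share i ≤ F.share z) :
    F.energy F.share ≤ F.share z := by
  calc F.energy F.share ≤ ∑ i, F.share z * F.share i :=
        Finset.sum_le_sum fun i _ => by
          rw [sq]; exact mul_le_mul_of_nonneg_right (hz i) (F.share_nonneg i)
    _ = F.share z := by rw [← Finset.mul_sum, sum_share, mul_one]

theorem measure_gossip_share_lt_le (ρ : unitInterval) (hρ : (ρ : ℝ) ≤ 1 / 4) {z : F.Root}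
    (hz : ∀ i, F.share i ≤ F.share z) {k t : ℕ} (hk : k ≤ t) :
    F.callMeasure ρ {ω | F.gossip ω F.share t z < F.share z / 4 * (1 / 2) ^ k} ≤
      ENNReal.ofReal (2 * (31 / 32) ^ k) := by
  obtain ⟨s, rfl⟩ := Nat.exists_eq_add_of_le hk
  refine (F.measure_gossip_add_lt_le ρ hρ hz k s F.share_nonneg F.sum_share).trans
    (ENNReal.ofReal_le_ofReal ?_)
  have hp := F.share_pos z
  have h1 : F.energy F.share / F.share z ≤ 1 := (div_le_one hp).2 (F.energy_share_le hz)
  have hs0 : (0 : ℝ) < (41 / 64) ^ s := by positivity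
  rw [mul_comm]
  refine mul_le_mul_of_nonneg_right ?_ (by positivity)
  have := mul_le_mul_of_nonneg_left h1 hs0.le
  linarith

theorem measure_lt_abs_gossip_le (ρ : unitInterval) (hρ : (ρ : ℝ) ≤ 1 / 4) {z : F.Root}
    (hz : ∀ i, F.share i ≤ F.share z) {d : F.Root → ℝ} (hd : ∑ i, d i = 0) {η : ℝ} (hη : 0 < η)
    (t : ℕ) :
    F.callMeasure ρ {ω | η * F.gossip ω F.share t z < |F.gossip ω d t z|} ≤
      ENNReal.ofReal ((2 + 16 * F.energy d / (η * F.share z) ^ 2) * (31 / 32) ^ (t / 4)) := by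
  -- The squared threshold costs 4^k against the energy decay (41/64)^t; as (41/64)^4 · 4 < 31/32, a
  -- quarter of the time is affordable.
  set k := t / 4 with hk
  have hkt : 4 * k ≤ t := Nat.mul_div_le t 4
  have hp := F.share_pos z
  have hE := F.energy_nonneg d
  have hε : 0 < (η * (F.share z / 4 * (1 / 2) ^ k)) ^ 2 := by positivity
  have hsub : {ω | η * F.gossip ω F.share t z < |F.gossip ω d t z|} ⊆
      {ω | F.gossip ω F.share t z < F.share z / 4 * (1 / 2) ^ k} ∪
      {ω | ENNReal.ofReal ((η * (F.share z / 4 * (1 / 2) ^ k)) ^ 2) ≤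
        ENNReal.ofReal (F.energy (F.gossip ω d t))} := by
    intro ω hω
    refine or_iff_not_imp_left.2 fun h => ENNReal.ofReal_le_ofReal ?_
    have h1 := mul_le_mul_of_nonneg_left (not_lt.1 h) hη.le
    have h2 : η * (F.share z / 4 * (1 / 2) ^ k) ≤ |F.gossip ω d t z| := h1.trans (le_of_lt hω)
    calc _ ≤ |F.gossip ω d t z| ^ 2 := pow_le_pow_left₀ (by positivity) h2 2
      _ = F.gossip ω d t z ^ 2 := sq_abs _
      _ ≤ _ := F.sq_le_energy _ z
  have hpow : (41 / 64 : ℝ) ^ t * 4 ^ k ≤ (31 / 32) ^ k :=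
    calc (41 / 64 : ℝ) ^ t * 4 ^ k ≤ (41 / 64) ^ (4 * k) * 4 ^ k :=
          mul_le_mul_of_nonneg_right
            (pow_le_pow_of_le_one (by norm_num) (by norm_num) hkt) (by positivity)
      _ = ((41 / 64) ^ 4 * 4) ^ k := by rw [pow_mul, mul_pow]
      _ ≤ _ := pow_le_pow_left₀ (by norm_num) (by norm_num) k
  refine (measure_mono hsub).trans ((measure_union_le _ _).trans ?_)
  rw [add_mul, ENNReal.ofReal_add (by positivity) (by positivity)]
  refine add_le_add (F.measure_gossip_share_lt_le ρ hρ hz (by lia)) ?_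
  refine (meas_ge_le_lintegral_div
    (F.measurable_energy.comp (F.measurable_gossip d t)).ennreal_ofReal.aemeasurable
    (by simpa using hε.ne') ENNReal.ofReal_ne_top).trans ?_
  refine (ENNReal.div_le_div_right (F.lintegral_energy_gossip_le ρ hρ t hd) _).trans ?_
  rw [← ENNReal.ofReal_div_of_pos hε]
  refine ENNReal.ofReal_le_ofReal ?_
  have h4 : ((1 / 2 : ℝ) ^ k) ^ 2 * 4 ^ k = 1 := by
    rw [← pow_mul, mul_comm k 2, pow_mul, ← mul_pow]; norm_num
  have heq : (41 / 64) ^ t * F.energy d / (η * (F.share z / 4 * (1 / 2) ^ k)) ^ 2 =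
      16 * F.energy d / (η * F.share z) ^ 2 * ((41 / 64) ^ t * 4 ^ k) := by
    rw [div_eq_iff hε.ne']
    calc _ = (41 / 64 : ℝ) ^ t * F.energy d * (((1 / 2 : ℝ) ^ k) ^ 2 * 4 ^ k) := by
          rw [h4, mul_one]
      _ = _ := by field_simp; ring
  rw [heq]
  exact mul_le_mul_of_nonneg_left hpow (by positivity)

/-- The probability that the accuracy `η` is violated at some time from `T` on decays
geometrically in `T`. -/
theorem measure_exists_lt_abs_gossip_le (ρ : unitInterval) (hρ : (ρ : ℝ) ≤ 1 / 4) {z : F.Root}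
    (hz : ∀ i, F.share i ≤ F.share z) {d : F.Root → ℝ} (hd : ∑ i, d i = 0) {η : ℝ} (hη : 0 < η)
    (T : ℕ) :
    F.callMeasure ρ {ω | ∃ t, T ≤ t ∧ η * F.gossip ω F.share t z < |F.gossip ω d t z|} ≤
      ENNReal.ofReal (256 * (2 + 16 * F.energy d / (η * F.share z) ^ 2) * (127 / 128) ^ T) := by
  set B := 2 + 16 * F.energy d / (η * F.share z) ^ 2 with hB
  have hB0 : 0 ≤ B := by have := F.energy_nonneg d; positivity
  -- Bernoulli gives (127/128)^4 ≥ 31/32, and the factor 2 covers the remainder t % 4 ≤ 3. With the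
  -- geometric sum 128 it makes the prefactor 256.
  have hpow : ∀ t : ℕ, (31 / 32 : ℝ) ^ (t / 4) ≤ 2 * (127 / 128) ^ t := fun t =>
    calc (31 / 32 : ℝ) ^ (t / 4) ≤ ((127 / 128) ^ 4) ^ (t / 4) :=
          pow_le_pow_left₀ (by norm_num) (by norm_num) _
      _ ≤ ((127 / 128) ^ 4) ^ (t / 4) * (2 * (127 / 128) ^ (t % 4)) := by
          refine le_mul_of_one_le_right (by positivity) ?_
          have : (127 / 128 : ℝ) ^ 3 ≤ (127 / 128) ^ (t % 4) :=
            pow_le_pow_of_le_one (by norm_num) (by norm_num) (by lia)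
          linarith [show (1 : ℝ) ≤ 2 * (127 / 128) ^ 3 by norm_num]
      _ = 2 * (127 / 128) ^ (4 * (t / 4) + t % 4) := by rw [pow_add, pow_mul]; ring
      _ = _ := by rw [Nat.div_add_mod]
  have hsub : {ω | ∃ t, T ≤ t ∧ η * F.gossip ω F.share t z < |F.gossip ω d t z|} ⊆
      ⋃ s : ℕ, {ω | η * F.gossip ω F.share (T + s) z < |F.gossip ω d (T + s) z|} := by
    rintro ω ⟨t, ht, h⟩
    obtain ⟨s, rfl⟩ := Nat.exists_eq_add_of_le ht
    exact Set.mem_iUnion.2 ⟨s, h⟩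
  have hgeo : HasSum (fun s : ℕ => 2 * B * (127 / 128) ^ T * (127 / 128 : ℝ) ^ s)
      (2 * B * (127 / 128) ^ T * (1 - 127 / 128)⁻¹) :=
    (hasSum_geometric_of_lt_one (by norm_num) (by norm_num)).mul_left _
  refine (measure_mono hsub).trans ((measure_iUnion_le _).trans ?_)
  refine (ENNReal.tsum_le_tsum (g := fun s : ℕ =>
    ENNReal.ofReal (2 * B * (127 / 128) ^ T * (127 / 128 : ℝ) ^ s)) fun s =>
      (F.measure_lt_abs_gossip_le ρ hρ hz hd hη (T + s)).trans (ENNReal.ofReal_le_ofReal ?_)).trans ?_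
  · refine (mul_le_mul_of_nonneg_left (hpow _) hB0).trans (le_of_eq ?_)
    rw [pow_add]; ring
  · rw [← ENNReal.ofReal_tsum_of_nonneg (fun s => by positivity) hgeo.summable, hgeo.tsum_eq]
    refine ENNReal.ofReal_le_ofReal (le_of_eq ?_)
    ring

end RankingForest

/-! ### From the deviation to the relative error, in terms of m, n and κ. -/

namespace RankingForest

variable {V : Type*} (F : RankingForest V) [Fintype V]

theorem gossip_zero (ω : F.Calls) (t : ℕ) (i : F.Root) : F.gossip ω (fun _ => 0) t i = 0 := by
  simpa using F.gossip_sub_smul ω (fun _ => 0) (fun _ => 0) 0 0 t i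

theorem sum_localSum (v : V → ℝ) : ∑ r, F.localSum v r = ∑ i, v i := F.sum_root_tree v

/-- The deviation of the local sums from the average, relative to the total. -/
def deviation (v : V → ℝ) (r : F.Root) : ℝ :=
  1 / (Fintype.card V * |nodeAverage v|) * F.localSum v r -
    nodeAverage v / |nodeAverage v| * F.share r

variable [Nonempty V]

theorem sum_eq_card_mul_nodeAverage (v : V → ℝ) :
    ∑ i, v i = Fintype.card V * nodeAverage v :=
  (mul_div_cancel₀ _ (by exact_mod_cast Fintype.card_ne_zero)).symm

theorem abs_sum_localSum (v : V → ℝ) :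
    |∑ r, F.localSum v r| = Fintype.card V * |nodeAverage v| := by
  rw [sum_localSum, sum_eq_card_mul_nodeAverage, abs_mul, Nat.abs_cast]

theorem one_le_cancellation {v : V → ℝ} (hv : nodeAverage v ≠ 0) : 1 ≤ F.cancellation v := by
  have hn : (0 : ℝ) < Fintype.card V := by exact_mod_cast Fintype.card_pos
  have h : 0 < |∑ r, F.localSum v r| := by
    rw [abs_sum_localSum]; exact mul_pos hn (abs_pos.2 hv)
  exact (one_le_div h).2 (Finset.abs_sum_le_sum_abs _ _)

theorem sum_deviation {v : V → ℝ} (hv : nodeAverage v ≠ 0) : ∑ r, F.deviation v r = 0 := by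
  have hn : (Fintype.card V : ℝ) ≠ 0 := by exact_mod_cast Fintype.card_ne_zero
  have ha : |nodeAverage v| ≠ 0 := abs_ne_zero.2 hv
  simp only [deviation, Finset.sum_sub_distrib, ← Finset.mul_sum, sum_share, sum_localSum,
    sum_eq_card_mul_nodeAverage]
  field_simp
  ring

/-- The ℓ² norm is at most the ℓ¹ norm, which is at most κ + 1 ≤ 2κ by the triangle inequality. -/
theorem energy_deviation_le {v : V → ℝ} (hv : nodeAverage v ≠ 0) :
    F.energy (F.deviation v) ≤ 4 * F.cancellation v ^ 2 := by
  have hn : (0 : ℝ) < Fintype.card V := by exact_mod_cast Fintype.card_pos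
  have ha : 0 < |nodeAverage v| := abs_pos.2 hv
  have h1 : ∑ r, |F.deviation v r| ≤ 2 * F.cancellation v := by
    calc ∑ r, |F.deviation v r|
        ≤ ∑ r, (1 / (Fintype.card V * |nodeAverage v|) * |F.localSum v r| + F.share r) := by
          refine Finset.sum_le_sum fun r _ => (abs_sub _ _).trans (le_of_eq ?_)
          rw [abs_mul, abs_mul, abs_div (nodeAverage v), abs_abs, div_self ha.ne',
            abs_of_nonneg (F.share_nonneg r), abs_of_nonneg (by positivity :
              0 ≤ 1 / (Fintype.card V * |nodeAverage v|)), one_mul]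
      _ = F.cancellation v + 1 := by
          rw [Finset.sum_add_distrib, ← Finset.mul_sum, sum_share, cancellation, abs_sum_localSum]
          ring
      _ ≤ _ := by linarith [F.one_le_cancellation hv]
  calc F.energy (F.deviation v) = ∑ r, |F.deviation v r| ^ 2 := by simp only [energy, sq_abs]
    _ ≤ (∑ r, |F.deviation v r|) ^ 2 := Finset.sum_sq_le_sq_sum_of_nonneg fun r _ => abs_nonneg _
    _ ≤ (2 * F.cancellation v) ^ 2 :=
        pow_le_pow_left₀ (Finset.sum_nonneg fun r _ => abs_nonneg _) h1 2
    _ = _ := by ring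

theorem gossip_share_pos (ω : F.Calls) (t : ℕ) (z : F.Root) : 0 < F.gossip ω F.share t z :=
  (mul_pos (by positivity) (F.share_pos z)).trans_le
    (F.half_pow_mul_le_gossip ω F.share_nonneg t z)

theorem relative_error_eq {v : V → ℝ} (hv : nodeAverage v ≠ 0) (ω : F.Calls) (t : ℕ)
    (z : F.Root) :
    |F.estimate v ω t z - nodeAverage v| / |nodeAverage v| =
      |F.gossip ω (F.deviation v) t z| / F.gossip ω F.share t z := by
  have hn : (0 : ℝ) < Fintype.card V := by exact_mod_cast Fintype.card_pos
  have ha : 0 < |nodeAverage v| := abs_pos.2 hv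
  have hG := F.gossip_share_pos ω t z
  have hsize : F.gossip ω (fun r => (F.treeSize r : ℝ)) t z =
      Fintype.card V * F.gossip ω F.share t z := by
    have h := F.gossip_sub_smul ω F.share F.share (Fintype.card V) 0 t z
    have hf : (fun r => (Fintype.card V : ℝ) * F.share r - 0 * F.share r) =
        fun r => (F.treeSize r : ℝ) := by
      funext r; rw [share]; field_simp; ring
    rw [hf] at h
    rw [h]; ring
  have hd : F.gossip ω (F.deviation v) t z = 1 / (Fintype.card V * |nodeAverage v|) *
      F.gossip ω (F.localSum v) t z - nodeAverage v / |nodeAverage v| * F.gossip ω F.share t z :=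
    F.gossip_sub_smul ω _ _ _ _ t z
  have hdG : F.gossip ω (F.deviation v) t z =
      (F.estimate v ω t z - nodeAverage v) / |nodeAverage v| * F.gossip ω F.share t z := by
    rw [hd, estimate, hsize]
    field_simp
  rw [hdG, abs_mul, abs_of_pos hG, mul_div_cancel_right₀ _ hG.ne', abs_div, abs_abs]

theorem inv_card_root_le_share {z : F.Root} (hz : ∀ i, F.share i ≤ F.share z) :
    1 / (Fintype.card F.Root : ℝ) ≤ F.share z := by
  have hm : (0 : ℝ) < Fintype.card F.Root := by exact_mod_cast Fintype.card_pos_iff.2 ⟨z⟩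
  rw [div_le_iff₀ hm, ← F.sum_share]
  refine (Finset.sum_le_sum fun i _ => hz i).trans (le_of_eq ?_)
  simp [mul_comm]

/-- The failure probability after `T` rounds in terms of the number of roots `m`, the number of
nodes and the cancellation ratio. -/
theorem measure_inaccurate_le (ρ : unitInterval) (hρ : (ρ : ℝ) ≤ 1 / 4) {z : F.Root}
    (hz : ∀ i, F.share i ≤ F.share z) {v : V → ℝ} (hv : nodeAverage v ≠ 0) {N : ℝ} (hN : 1 < N)
    (T : ℕ) :
    F.callMeasure ρ {ω | ∃ t, T ≤ t ∧ 2 / (N - 1) * F.gossip ω F.share t z <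
        |F.gossip ω (F.deviation v) t z|} ≤
      ENNReal.ofReal (4608 * (F.cancellation v * Fintype.card F.Root * N) ^ 2 *
        (127 / 128) ^ T) := by
  have hN0 : 0 < N - 1 := sub_pos.2 hN
  have hp := F.share_pos z
  have hm : (1 : ℝ) ≤ Fintype.card F.Root := by exact_mod_cast Fintype.card_pos_iff.2 ⟨z⟩
  have hκ := F.one_le_cancellation hv
  refine (F.measure_exists_lt_abs_gossip_le ρ hρ hz (F.sum_deviation hv)
    (div_pos two_pos hN0) T).trans (ENNReal.ofReal_le_ofReal ?_)
  refine mul_le_mul_of_nonneg_right ?_ (by positivity)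
  have hinv : 1 / (2 / (N - 1) * F.share z) ≤ N * Fintype.card F.Root / 2 := by
    rw [div_le_iff₀ (by positivity)]
    have h1 : 1 ≤ F.share z * Fintype.card F.Root :=
      (div_le_iff₀ (by linarith)).1 (F.inv_card_root_le_share hz)
    have h2 : 1 ≤ N / (N - 1) := (one_le_div hN0).2 (by linarith)
    calc (1 : ℝ) ≤ N / (N - 1) * (F.share z * Fintype.card F.Root) :=
          one_le_mul_of_one_le_of_one_le h2 h1
      _ = _ := by field_simp
  have hsq : 1 / (2 / (N - 1) * F.share z) ^ 2 ≤ (N * Fintype.card F.Root / 2) ^ 2 := by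
    rw [← one_div_pow]
    exact pow_le_pow_left₀ (by positivity) hinv 2
  have hprod : 1 ≤ (F.cancellation v * Fintype.card F.Root * N) ^ 2 :=
    one_le_pow₀ (one_le_mul_of_one_le_of_one_le (one_le_mul_of_one_le_of_one_le hκ hm) hN.le)
  -- This contributes 16 (κmN)², the additive 2 at most 2 (κmN)², and 256 · 18 = 4608.
  have hmain : 16 * F.energy (F.deviation v) / (2 / (N - 1) * F.share z) ^ 2 ≤
      16 * (4 * F.cancellation v ^ 2) * (N * Fintype.card F.Root / 2) ^ 2 := by
    rw [div_eq_mul_one_div]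
    refine mul_le_mul (mul_le_mul_of_nonneg_left (F.energy_deviation_le hv) (by norm_num)) hsq
      (by positivity) (by positivity)
  have hring : 16 * (4 * F.cancellation v ^ 2) * (N * Fintype.card F.Root / 2) ^ 2 =
      16 * (F.cancellation v * Fintype.card F.Root * N) ^ 2 := by ring
  linarith

theorem one_sub_le_measureReal_accurate (ρ : unitInterval) (z : F.Root) {v : V → ℝ}
    (hv : nodeAverage v ≠ 0) {η ε : ℝ} (hε : 0 ≤ ε) (T : ℕ)
    (h : F.callMeasure ρ {ω | ∃ t, T ≤ t ∧ η * F.gossip ω F.share t z <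
        |F.gossip ω (F.deviation v) t z|} ≤ ENNReal.ofReal ε) :
    1 - ε ≤ (F.callMeasure ρ).real {ω | ∀ t, T ≤ t →
      |F.estimate v ω t z - nodeAverage v| / |nodeAverage v| ≤ η} := by
  have hcover : (Set.univ : Set F.Calls) ⊆ {ω | ∀ t, T ≤ t →
      |F.estimate v ω t z - nodeAverage v| / |nodeAverage v| ≤ η} ∪ {ω | ∃ t, T ≤ t ∧
        η * F.gossip ω F.share t z < |F.gossip ω (F.deviation v) t z|} := by
    intro ω _
    refine or_iff_not_imp_right.2 fun hω t ht => ?_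
    rw [F.relative_error_eq hv, div_le_iff₀ (F.gossip_share_pos ω t z)]
    exact not_lt.1 fun hlt => hω ⟨t, ht, hlt⟩
  have h1 := (measureReal_mono hcover (by finiteness)).trans
    (measureReal_union_le (μ := F.callMeasure ρ) _ _)
  rw [probReal_univ] at h1
  have h2 := ENNReal.toReal_le_of_le_ofReal hε h
  change (F.callMeasure ρ).real _ ≤ ε at h2
  linarith

end RankingForest

/-! ### The choice of the time T. -/

theorem pow_le_exp_neg_div (T : ℕ) : (127 / 128 : ℝ) ^ T ≤ Real.exp (-(T / 128)) := by
  have h : (127 / 128 : ℝ) ≤ Real.exp (-(1 / 128)) := by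
    have := Real.add_one_le_exp (-(1 / 128 : ℝ))
    linarith
  refine (pow_le_pow_left₀ (by norm_num) h T).trans (le_of_eq ?_)
  rw [← Real.exp_nat_mul]
  congr 1
  ring

theorem failure_bound_le {κ m N : ℝ} (hκ : 1 ≤ κ) (hm : 2 ≤ m) (hN : 1 < N) {T : ℕ}
    (hT : 128 * (2 * Real.log κ + 15 * Real.log m + 3 * Real.log N) ≤ T) :
    4608 * (κ * m * N) ^ 2 * (127 / 128) ^ T ≤ 1 / N := by
  have hκ0 : 0 < κ := by linarith
  have hm0 : 0 < m := by linarith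
  have hN0 : 0 < N := by linarith
  -- With at least two roots the numerical prefactor is absorbed into a power of m, so T needs no
  -- additive constant.
  have h13 : (4608 : ℝ) ≤ m ^ 13 :=
    (by norm_num : (4608 : ℝ) ≤ 2 ^ 13).trans (pow_le_pow_left₀ (by norm_num) hm 13)
  have hexp : (127 / 128 : ℝ) ^ T ≤ 1 / (κ ^ 2 * m ^ 15 * N ^ 3) := by
    refine (pow_le_exp_neg_div T).trans ?_
    have h := Real.exp_log (show 0 < 1 / (κ ^ 2 * m ^ 15 * N ^ 3) by positivity)
    rw [← h, Real.exp_le_exp, one_div, Real.log_inv,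
      Real.log_mul (by positivity) (by positivity), Real.log_mul (by positivity) (by positivity),
      Real.log_pow, Real.log_pow, Real.log_pow]
    push_cast
    linarith
  calc 4608 * (κ * m * N) ^ 2 * (127 / 128) ^ T
      ≤ m ^ 13 * (κ * m * N) ^ 2 * (1 / (κ ^ 2 * m ^ 15 * N ^ 3)) := by gcongr
    _ = 1 / N := by field_simp

end

theorem mainTheorem6 :
    ∃ C : ℝ, 0 < C ∧
      ∀ (V : Type*) [Fintype V] (F : RankingForest V) (v : V → ℝ)
        (ρ : unitInterval) (α : ℝ) (z : F.Root),
        2 ≤ Fintype.card V → (ρ : ℝ) ≤ 1 / 4 → 0 < α → nodeAverage v ≠ 0 →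
        (∀ r, F.treeSize r ≤ F.treeSize z) →
        ∃ T : ℕ,
          (T : ℝ) ≤ C * (Real.log (Fintype.card F.Root) + α * Real.log (Fintype.card V)
            + Real.log (F.cancellation v)) ∧
          (T : ℝ) ≤ C * ((1 + α) * Real.log (Fintype.card V) + Real.log (F.cancellation v)) ∧
          1 - 1 / (Fintype.card V : ℝ) ^ α ≤
            (F.callMeasure ρ).real {ω | ∀ t, T ≤ t →
              |F.estimate v ω t z - nodeAverage v| / |nodeAverage v|
                ≤ 2 / ((Fintype.card V : ℝ) ^ α - 1)} := by
  refine ⟨2000, by norm_num, fun V _ F v ρ α z hn hρ hα hv hz => ?_⟩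
  have : Nonempty V := ⟨z⟩
  have hn2 : (2 : ℝ) ≤ Fintype.card V := by exact_mod_cast hn
  have hn0 : (0 : ℝ) < Fintype.card V := by linarith
  have hN : 1 < (Fintype.card V : ℝ) ^ α := Real.one_lt_rpow (by linarith) hα
  have hlogn : 0 ≤ α * Real.log (Fintype.card V) :=
    mul_nonneg hα.le (Real.log_nonneg (by linarith))
  have hκ := F.one_le_cancellation hv
  have hlogκ : 0 ≤ Real.log (F.cancellation v) := Real.log_nonneg hκ
  have hm1 : 1 ≤ Fintype.card F.Root := Fintype.card_pos_iff.2 ⟨z⟩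
  have hmn : Real.log (Fintype.card F.Root) ≤ Real.log (Fintype.card V) :=
    Real.log_le_log (by exact_mod_cast hm1)
      (by exact_mod_cast Fintype.card_subtype_le fun i => F.parent i = none)
  have hlogm : 0 ≤ Real.log (Fintype.card F.Root) := Real.log_nonneg (by exact_mod_cast hm1)
  have hshare : ∀ i, F.share i ≤ F.share z := fun i =>
    div_le_div_of_nonneg_right (by exact_mod_cast hz i) hn0.le
  suffices h : ∃ T : ℕ, (T : ℝ) ≤ 2000 * (Real.log (Fintype.card F.Root) +
      α * Real.log (Fintype.card V) + Real.log (F.cancellation v)) ∧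
      F.callMeasure ρ {ω | ∃ t, T ≤ t ∧ 2 / ((Fintype.card V : ℝ) ^ α - 1) *
        F.gossip ω F.share t z < |F.gossip ω (F.deviation v) t z|} ≤
        ENNReal.ofReal (1 / (Fintype.card V : ℝ) ^ α) by
    obtain ⟨T, hT, hbad⟩ := h
    exact ⟨T, hT, hT.trans (by linarith),
      F.one_sub_le_measureReal_accurate ρ z hv (by positivity) T hbad⟩
  -- A single root has log m = 0, and α log n may be arbitrarily small, so no constant can be
  -- absorbed. But then the deviation vanishes and T = 0 works.
  rcases hm1.eq_or_lt with hm | hm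
  · refine ⟨0, by rw [Nat.cast_zero]; positivity, ?_⟩
    have := Fintype.card_le_one_iff_subsingleton.1 hm.ge
    have hd : F.deviation v = fun _ => 0 := by
      funext r
      have hs := F.sum_deviation hv
      rwa [Fintype.sum_subsingleton _ r] at hs
    have hempty : {ω : F.Calls | ∃ t, 0 ≤ t ∧ 2 / ((Fintype.card V : ℝ) ^ α - 1) *
        F.gossip ω F.share t z < |F.gossip ω (F.deviation v) t z|} = ∅ := by
      refine Set.eq_empty_of_forall_notMem fun ω hω => ?_
      obtain ⟨t, -, ht⟩ := hω
      rw [hd, F.gossip_zero, abs_zero] at ht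
      exact ht.not_ge (mul_nonneg (div_nonneg two_pos.le (sub_nonneg.2 hN.le))
        (F.gossip_share_pos ω t z).le)
    rw [hempty, measure_empty]
    exact zero_le
  · have hm2 : (2 : ℝ) ≤ Fintype.card F.Root := by exact_mod_cast hm
    have hlog2 : 1 / 2 ≤ Real.log (Fintype.card F.Root) :=
      (by linarith [Real.log_two_gt_d9] : 1 / 2 ≤ Real.log 2).trans
        (Real.log_le_log two_pos hm2)
    have hlogN : Real.log ((Fintype.card V : ℝ) ^ α) = α * Real.log (Fintype.card V) :=
      Real.log_rpow hn0 α
    refine ⟨⌈128 * (2 * Real.log (F.cancellation v) + 15 * Real.log (Fintype.card F.Root) +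
      3 * Real.log ((Fintype.card V : ℝ) ^ α))⌉₊, ?_, ?_⟩
    -- Rounding up costs 1 ≤ 2 log m, and 128 · 15 + 2 = 1922 ≤ 2000.
    · refine (Nat.ceil_lt_add_one (by rw [hlogN]; positivity)).le.trans ?_
      rw [hlogN]
      linarith
    · exact (F.measure_inaccurate_le ρ hρ hshare hv hN _).trans
        (ENNReal.ofReal_le_ofReal (failure_bound_le hκ hm2 hN (Nat.le_ceil _)))
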